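/- Let $R$ and $S$ be associative rings with identity. Write $\operatorname{Mod}S$ for the category of left $S$-modules, and $S^{op}$-module for right $S$-module. Let ${}_RC_S$ be a semidualizing $(R,S)$-bimodule, that is: ${}_RC$ and $C_S$ each admit a projective resolution by finitely generated projective modules; the homothety maps $R\to\operatorname{Hom}_{S^{op}}(C,C)$, $r\mapsto(c\mapsto rc)$, and $S\to\operatorname{Hom}_R(C,C)$, $s\mapsto(c\mapsto cs)$, are bijective; and $\operatorname{Ext}_R^{i}(C,C)=0=\operatorname{Ext}_{S^{op}}^{i}(C,C)$ for all $i\ge 1$. The Auslander class $\mathcal A_C(S)$ consists of all $N\in\operatorname{Mod}S$ such that $\operatorname{Tor}^S_i(C,N)=0$ and $\operatorname{Ext}^i_R(C,C\otimes_SN)=0$ for all $i\ge1$ and such that the canonical map $\mu_N:N\to\operatorname{Hom}_R(C,C\otimes_SN)$, $\mu_N(x)(c)=c\otimes x$, is an isomorphism. The Auslander projective dimension $\mathcal A_C(S)\text{-}\operatorname{pd}_SN$ of $N\in\operatorname{Mod}S$ is the infimum of all integers $m\ge0$ for which there is an exact sequence $0\to X_m\to\cdots\to X_1\to X_0\to N\to0$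 in $\operatorname{Mod}S$ with all $X_i\in\mathcal A_C(S)$ (and $\infty$ if there is no such $m$). An $R$-module $X$ has an ultimately closed projective resolution if there are a projective resolution $\cdots\to P_1\xrightarrow{g_1}P_0\xrightarrow{g_0}X\to0$ and an integer $m\ge1$ such that $\operatorname{Im}g_m\cong\bigoplus_jW_j$, where each $W_j$ is isomorphic to a direct summand of some $\operatorname{Im}g_{i_j}$ with $0\le i_j<m$. **Corollary 4.11.** If ${}_RC$ has an ultimately closed projective resolution, then for every integer $n\ge0$ the following statements are equivalent: 1. the projective dimension of the right $S$-module $C_S$ is at most $n$, i.e. $\operatorname{pd}_{S^{op}}C\le n$; 2. $\mathcal A_C(S)\text{-}\operatorname{pd}_SN\le n$ for every $N\in\operatorname{Mod}S$. -/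

import Mathlib

open CategoryTheory
open scoped TensorProduct DirectSum

universe u

namespace SemidualizingBimodule

noncomputable section

/-! An `(R, S)`-bimodule `C` is a left `R`-module `C` that is also a right `S`-module, i.e. a module
over `Sᵐᵒᵖ`, such that the two actions commute.  `Mod S` is `ModuleCat S`, and right `S`-modules are
the objects of `ModuleCat Sᵐᵒᵖ`. -/

section Tensor

variable (R S : Type u) [Ring R] [Ring S] (C : Type u) [AddCommGroup C] [Module R C]
  [Module Sᵐᵒᵖ C]

/-- The relations `(c s) ⊗ x = c ⊗ (s x)` by which `C ⊗[S] N` is a quotient of `C ⊗[ℤ] N`.  When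
the actions of `R` and `S` on `C` commute, the generating set is stable under `R`, so that its
`R`-span is the additive subgroup that it generates. -/
def balancedRelations (N : Type u) [AddCommGroup N] [Module S N] : Submodule R (C ⊗[ℤ] N) :=
  Submodule.span R {t | ∃ (c : C) (s : S) (x : N),
    t = (MulOpposite.op s • c) ⊗ₜ[ℤ] x - c ⊗ₜ[ℤ] (s • x)}

/-- The tensor product `C ⊗[S] N` of an `(R, S)`-bimodule and a left `S`-module, a left `R`-module
through the action of `R` on `C`. -/
abbrev BalancedTensor (N : Type u) [AddCommGroup N] [Module S N] : Type u :=
  (C ⊗[ℤ] N) ⧸ balancedRelations R S C N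

variable {C} in
/-- The class of the pure tensor `c ⊗ x` in `C ⊗[S] N`. -/
def tmul {N : Type u} [AddCommGroup N] [Module S N] (c : C) (x : N) : BalancedTensor R S C N :=
  (balancedRelations R S C N).mkQ (c ⊗ₜ[ℤ] x)

/-- The map `1_C ⊗ f : C ⊗[S] N → C ⊗[S] N'` induced by an `S`-linear map `f : N → N'`. -/
def tensorMap {N N' : Type u} [AddCommGroup N] [Module S N] [AddCommGroup N'] [Module S N']
    (f : N →ₗ[S] N') : BalancedTensor R S C N →ₗ[R] BalancedTensor R S C N' :=
  Submodule.mapQ (balancedRelations R S C N) (balancedRelations R S C N')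
    (TensorProduct.AlgebraTensorModule.map (LinearMap.id : C →ₗ[R] C) (f.restrictScalars ℤ)) (by
      rw [balancedRelations, Submodule.span_le]
      rintro _ ⟨c, s, x, rfl⟩
      refine Submodule.subset_span ⟨c, s, f x, ?_⟩
      simp)

variable {S} in
theorem tensorMap_tmul {N N' : Type u} [AddCommGroup N] [Module S N] [AddCommGroup N']
    [Module S N'] (f : N →ₗ[S] N') (c : C) (x : N) :
    tensorMap R S C f (tmul R S c x) = tmul R S c (f x) := by
  simp [tensorMap, tmul]

variable {R S C} in
/-- Two `R`-linear maps out of `C ⊗[S] N` are equal if they agree on pure tensors. -/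
theorem balancedTensor_hom_ext {N : Type u} [AddCommGroup N] [Module S N] {X : Type u}
    [AddCommGroup X] [Module R X] {f g : BalancedTensor R S C N →ₗ[R] X}
    (h : ∀ c x, f (tmul R S c x) = g (tmul R S c x)) : f = g := by
  apply Submodule.linearMap_qext
  apply TensorProduct.AlgebraTensorModule.ext
  intro c x
  exact h c x

/-- The functor `C ⊗[S] - : Mod S ⥤ Mod R`. -/
def tensorFunctor : ModuleCat.{u} S ⥤ ModuleCat.{u} R where
  obj N := ModuleCat.of R (BalancedTensor R S C N)
  map f := ModuleCat.ofHom (tensorMap R S C f.hom)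
  map_id N := by
    ext1
    apply balancedTensor_hom_ext
    intro c x
    simp [tensorMap_tmul]
  map_comp f g := by
    ext1
    apply balancedTensor_hom_ext
    intro c x
    simp [tensorMap_tmul]

instance : (tensorFunctor R S C).Additive where
  map_add {N N' f g} := by
    ext1
    apply balancedTensor_hom_ext
    intro c x
    change tensorMap R S C (f.hom + g.hom) (tmul R S c x) =
      tensorMap R S C f.hom (tmul R S c x) + tensorMap R S C g.hom (tmul R S c x)
    simp only [tensorMap_tmul]
    simp [tmul, TensorProduct.tmul_add]

/-- `Tor_i^S(C, N)`, the `i`-th left derived functor of `C ⊗[S] -` at `N`, with its left `R`-module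
structure. -/
def bimoduleTor (i : ℕ) (N : ModuleCat.{u} S) : ModuleCat.{u} R :=
  ((tensorFunctor R S C).leftDerived i).obj N

variable [SMulCommClass R Sᵐᵒᵖ C]

/-- The canonical map `μ_N : N → Hom_R(C, C ⊗[S] N)`, `μ_N(x)(c) = c ⊗ x`.  With respect to
the usual left action `(s φ)(c) = φ (c s)` of `S` on `Hom_R(C, C ⊗[S] N)` it is `S`-linear, so it is
an isomorphism in `Mod S` if and only if it is bijective. -/
def valuation (N : Type u) [AddCommGroup N] [Module S N] :
    N →+ (C →ₗ[R] BalancedTensor R S C N) where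
  toFun x :=
    { toFun := fun c => tmul R S c x
      map_add' := fun c c' => by simp [tmul, TensorProduct.add_tmul]
      map_smul' := fun r c => by simp [tmul, ← TensorProduct.smul_tmul'] }
  map_zero' := by ext c; simp [tmul]
  map_add' x y := by ext c; simp [tmul, TensorProduct.tmul_add]

/-- The Auslander class `𝒜_C(S)` in `Mod S`. -/
structure auslanderClass (N : ModuleCat.{u} S) : Prop where
  tor_eq_zero : ∀ i : ℕ, 1 ≤ i → Limits.IsZero (bimoduleTor R S C i N)
  ext_eq_zero : ∀ i : ℕ, 1 ≤ i →
    Subsingleton (Abelian.Ext (ModuleCat.of R C) (ModuleCat.of R (BalancedTensor R S C N)) i)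
  valuation_bijective : Function.Bijective (valuation R S C N)

end Tensor

/-- The module `M` admits a projective resolution by finitely generated projective modules. -/
def HasDegreewiseFiniteResolution {A : Type u} [Ring A] (M : ModuleCat.{u} A) : Prop :=
  ∃ P : ProjectiveResolution M, ∀ i : ℕ, Module.Finite A (P.complex.X i)

/-- The `(R, S)`-bimodule `C` is semidualizing.  The homothety maps are `R → Hom_{Sᵒᵖ}(C, C)`,
`r ↦ (c ↦ r c)`, and `S → Hom_R(C, C)`, `s ↦ (c ↦ c s)`. -/
structure IsSemidualizing (R S : Type u) [Ring R] [Ring S] (C : Type u) [AddCommGroup C]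
    [Module R C] [Module Sᵐᵒᵖ C] [SMulCommClass R Sᵐᵒᵖ C] : Prop where
  finite_left : HasDegreewiseFiniteResolution (ModuleCat.of R C)
  finite_right : HasDegreewiseFiniteResolution (ModuleCat.of Sᵐᵒᵖ C)
  homothety_left : Function.Bijective
    (fun r : R => (Module.toModuleEnd Sᵐᵒᵖ (S := R) C r : C →ₗ[Sᵐᵒᵖ] C))
  homothety_right : haveI := SMulCommClass.symm R Sᵐᵒᵖ C
    Function.Bijective
      (fun s : S => (Module.toModuleEnd R (S := Sᵐᵒᵖ) C (MulOpposite.op s) : C →ₗ[R] C))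
  ext_left : ∀ i : ℕ, 1 ≤ i →
    Subsingleton (Abelian.Ext (ModuleCat.of R C) (ModuleCat.of R C) i)
  ext_right : ∀ i : ℕ, 1 ≤ i →
    Subsingleton (Abelian.Ext (ModuleCat.of Sᵐᵒᵖ C) (ModuleCat.of Sᵐᵒᵖ C) i)

section UltimatelyClosed

variable {A : Type u} [Ring A]

/-- The image of the `k`-th map `g_k` of a projective resolution
`⋯ → P₂ → P₁ → P₀ → X → 0`, where `g₀ : P₀ → X` is the augmentation (which is onto, so that its
image is `X`) and `g_{k+1} : P_{k+1} → P_k`. -/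
def resolutionImage {X : ModuleCat.{u} A} (P : ProjectiveResolution X) : ℕ → ModuleCat.{u} A
  | 0 => X
  | k + 1 => ModuleCat.of A (LinearMap.range (P.complex.d (k + 1) k).hom)

/-- `W` is isomorphic to a direct summand of `M`. -/
def IsDirectSummand (W M : ModuleCat.{u} A) : Prop :=
  ∃ V : ModuleCat.{u} A, Nonempty (M ≃ₗ[A] W × V)

/-- The projective resolution `P` is ultimately closed at `n`: the image of `g_n` is a (possibly
infinite) direct sum of modules each of which is isomorphic to a direct summand of the image of
some `g_i` with `i < n`. -/
def IsUltimatelyClosedAt {X : ModuleCat.{u} A} (P : ProjectiveResolution X) (n : ℕ) : Prop :=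
  ∃ (ι : Type u) (W : ι → ModuleCat.{u} A),
    Nonempty (resolutionImage P n ≃ₗ[A] ⨁ j, W j) ∧
    ∀ j, ∃ i < n, IsDirectSummand (W j) (resolutionImage P i)

/-- `X` has an ultimately closed projective resolution. -/
def HasUltimatelyClosedResolution (X : ModuleCat.{u} A) : Prop :=
  ∃ n : ℕ, 1 ≤ n ∧ ∃ P : ProjectiveResolution X, IsUltimatelyClosedAt P n

end UltimatelyClosed

section RelativeDimension

variable {A : Type u} [Ring A]

/-- There is an exact sequence `0 → X_n → ⋯ → X₁ → X₀ → N → 0` with all `X_i` in the class `𝒳`.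
The sequence is continued to the left by zero modules; exactness at `X_n` then says that the map
leaving `X_n` is injective. -/
def HasResolutionOfLength (𝒳 : ModuleCat.{u} A → Prop) (N : ModuleCat.{u} A) (n : ℕ) : Prop :=
  ∃ (X : ℕ → ModuleCat.{u} A) (d : ∀ i, X (i + 1) →ₗ[A] X i) (ε : X 0 →ₗ[A] N),
    (∀ i ≤ n, 𝒳 (X i)) ∧ (∀ i, n < i → Subsingleton (X i)) ∧
    Function.Surjective ε ∧ Function.Exact (d 0) ε ∧
    ∀ i, Function.Exact (d (i + 1)) (d i)

/-- The `𝒳`-projective dimension of `N`: the least length of a resolution of `N` by modules in `𝒳`,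
and `⊤` if there is none. -/
def relativeProjectiveDimension (𝒳 : ModuleCat.{u} A → Prop) (N : ModuleCat.{u} A) : ℕ∞ :=
  sInf {k : ℕ∞ | ∃ n : ℕ, k = n ∧ HasResolutionOfLength 𝒳 N n}

end RelativeDimension

/-- The Auslander projective dimension of a left `S`-module `N`. -/
def auslanderProjectiveDimension (R S : Type u) [Ring R] [Ring S] (C : Type u) [AddCommGroup C]
    [Module R C] [Module Sᵐᵒᵖ C] [SMulCommClass R Sᵐᵒᵖ C] (N : ModuleCat.{u} S) : ℕ∞ :=
  relativeProjectiveDimension (auslanderClass R S C) N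

end

end SemidualizingBimodule

/-! Write `M⁺ = Hom_ℤ(M, ℚ/ℤ)`. Since `(C ⊗[S] N)⁺ ≃ Hom_S(N, C⁺)`, the vanishing of `Tor_i^S(C, N)`
is that of `Ext_S^i(N, C⁺)`. As `C` has a resolution by finitely generated projective right modules,
`pd C ≤ n` if and only if `C⁺` has injective dimension at most `n`, which means that
`Tor_{n+1}^S(C, -) = 0`.

The class `𝒜_C(S)` contains the projective modules, so it remains to see that `N ∈ 𝒜_C(S)` whenever
`Tor_i^S(C, N) = 0` for all `i ≥ 1`: this applies to the `n`-th syzygy of a module whose `Tor_i`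
vanish for `i > n`. Let `K` be the `(m + 2)`-nd syzygy of such an `N`, where a projective resolution
of the left module `C` is ultimately closed at `m`. Dimension shifting gives
`Ext_R^i(C, C ⊗[S] K) = 0` for `1 ≤ i ≤ m`, hence for all `i ≥ 1` because the `m`-th syzygy of `C`
is a direct sum of summands of earlier ones. Therefore `K ∈ 𝒜_C(S)`. Finally `𝒜_C(S)` is closed
under cokernels of monomorphisms that stay monic after tensoring with `C`, so membership descends
along the resolution from `K` to `N`. -/

namespace SemidualizingBimodule

open Abelian Limits

noncomputable section

section ExtVanishing

universe w v' u'

variable {𝒞 : Type u'} [Category.{v'} 𝒞] [Abelian 𝒞] [HasExt.{w} 𝒞]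

theorem subsingleton_ext_succ_left_iff {T : ShortComplex 𝒞} (hT : T.ShortExact) (Y : 𝒞) (i : ℕ)
    (h : Subsingleton (Ext T.X₂ Y i)) (h' : Subsingleton (Ext T.X₂ Y (i + 1))) :
    Subsingleton (Ext T.X₃ Y (i + 1)) ↔ Subsingleton (Ext T.X₁ Y i) := by
  refine ⟨fun h₃ => subsingleton_of_forall_eq 0 fun x => ?_,
    fun h₁ => subsingleton_of_forall_eq 0 fun x => ?_⟩
  · obtain ⟨y, rfl⟩ := Ext.contravariant_sequence_exact₁ hT Y x (add_comm 1 i) (h₃.elim _ _)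
    rw [h.elim y 0, Ext.comp_zero]
  · obtain ⟨y, rfl⟩ := Ext.contravariant_sequence_exact₃ hT Y x (h'.elim _ _) (add_comm 1 i)
    rw [h₁.elim y 0, Ext.comp_zero]

theorem subsingleton_ext_succ_right_iff {T : ShortComplex 𝒞} (hT : T.ShortExact) (X : 𝒞) (i : ℕ)
    (h : Subsingleton (Ext X T.X₂ i)) (h' : Subsingleton (Ext X T.X₂ (i + 1))) :
    Subsingleton (Ext X T.X₁ (i + 1)) ↔ Subsingleton (Ext X T.X₃ i) := by
  refine ⟨fun h₁ => subsingleton_of_forall_eq 0 fun x => ?_,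
    fun h₃ => subsingleton_of_forall_eq 0 fun x => ?_⟩
  · obtain ⟨y, rfl⟩ := Ext.covariant_sequence_exact₃ X hT x rfl (h₁.elim _ _)
    rw [h.elim y 0, Ext.zero_comp]
  · obtain ⟨y, rfl⟩ := Ext.covariant_sequence_exact₁ X hT x (h'.elim _ _) rfl
    rw [h₃.elim y 0, Ext.zero_comp]

theorem exists_extension_of_subsingleton_ext_one {T : ShortComplex 𝒞} (hT : T.ShortExact) {Y : 𝒞}
    (h : Subsingleton (Ext T.X₃ Y 1)) (φ : T.X₁ ⟶ Y) : ∃ ψ : T.X₂ ⟶ Y, T.f ≫ ψ = φ := by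
  obtain ⟨y, hy⟩ := Ext.contravariant_sequence_exact₁ hT Y (Ext.mk₀ φ) (add_zero 1) (h.elim _ _)
  obtain ⟨ψ, rfl⟩ := (Ext.mk₀_bijective _ _).surjective y
  exact ⟨ψ, (Ext.mk₀_bijective _ _).injective (by rwa [← Ext.mk₀_comp_mk₀])⟩

theorem exists_lift_of_subsingleton_ext_one {T : ShortComplex 𝒞} (hT : T.ShortExact) {X : 𝒞}
    (h : Subsingleton (Ext X T.X₁ 1)) (φ : X ⟶ T.X₃) : ∃ ψ : X ⟶ T.X₂, ψ ≫ T.g = φ := by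
  obtain ⟨y, hy⟩ := Ext.covariant_sequence_exact₃ X hT (Ext.mk₀ φ) rfl (h.elim _ _)
  obtain ⟨ψ, rfl⟩ := (Ext.mk₀_bijective _ _).surjective y
  exact ⟨ψ, (Ext.mk₀_bijective _ _).injective (by rwa [← Ext.mk₀_comp_mk₀])⟩

theorem subsingleton_ext_one_of_forall_exists_lift {T : ShortComplex 𝒞} (hT : T.ShortExact) {X : 𝒞}
    (h : Subsingleton (Ext X T.X₂ 1)) (hlift : ∀ φ : X ⟶ T.X₃, ∃ ψ : X ⟶ T.X₂, ψ ≫ T.g = φ) :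
    Subsingleton (Ext X T.X₁ 1) :=
  subsingleton_of_forall_eq 0 fun x => by
    obtain ⟨y, rfl⟩ := Ext.covariant_sequence_exact₁ X hT x (h.elim _ _) (zero_add 1)
    obtain ⟨φ, rfl⟩ := (Ext.mk₀_bijective _ _).surjective y
    obtain ⟨ψ, rfl⟩ := hlift φ
    rw [← Ext.mk₀_comp_mk₀, Ext.comp_assoc_of_second_deg_zero, hT.comp_extClass, Ext.comp_zero]

theorem subsingleton_ext_left_of_retract {W X : 𝒞} (r : Retract W X) {Y : 𝒞} {i : ℕ}
    (h : Subsingleton (Ext X Y i)) : Subsingleton (Ext W Y i) :=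
  subsingleton_of_forall_eq 0 fun x => by
    rw [← x.mk₀_id_comp, ← r.retract, ← Ext.mk₀_comp_mk₀, Ext.comp_assoc_of_second_deg_zero,
      h.elim ((Ext.mk₀ r.r).comp x (zero_add i)) 0, Ext.comp_zero]

theorem subsingleton_ext_right_of_retract {Y Z : 𝒞} (r : Retract Y Z) {X : 𝒞} {i : ℕ}
    (h : Subsingleton (Ext X Z i)) : Subsingleton (Ext X Y i) :=
  subsingleton_of_forall_eq 0 fun x => by
    rw [← x.comp_mk₀_id, ← r.retract, ← Ext.mk₀_comp_mk₀, ← Ext.comp_assoc_of_third_deg_zero,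
      h.elim (x.comp (Ext.mk₀ r.i) (add_zero i)) 0, Ext.zero_comp]

theorem subsingleton_ext_succ_iff_projectiveResolution {X : 𝒞} (P : ProjectiveResolution X) (Y : 𝒞)
    (k : ℕ) : Subsingleton (Ext X Y (k + 1)) ↔
      ∀ φ : P.complex.X (k + 1) ⟶ Y, P.complex.d (k + 2) (k + 1) ≫ φ = 0 →
        ∃ ψ : P.complex.X k ⟶ Y, P.complex.d (k + 1) k ≫ ψ = φ := by
  refine ⟨fun h φ hφ => (P.extMk_eq_zero_iff φ _ rfl hφ k rfl).1 (h.elim _ _),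
    fun h => subsingleton_of_forall_eq 0 fun x => ?_⟩
  obtain ⟨φ, hφ, rfl⟩ := P.extMk_surjective x _ rfl
  exact (P.extMk_eq_zero_iff φ _ rfl hφ k rfl).2 (h φ hφ)

theorem subsingleton_ext_succ_iff_injectiveResolution (X : 𝒞) {Y : 𝒞} (I : InjectiveResolution Y)
    (k : ℕ) : Subsingleton (Ext X Y (k + 1)) ↔
      ∀ φ : X ⟶ I.cocomplex.X (k + 1), φ ≫ I.cocomplex.d (k + 1) (k + 2) = 0 →
        ∃ ψ : X ⟶ I.cocomplex.X k, ψ ≫ I.cocomplex.d k (k + 1) = φ := by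
  refine ⟨fun h φ hφ => (I.extMk_eq_zero_iff φ _ rfl hφ k rfl).1 (h.elim _ _),
    fun h => subsingleton_of_forall_eq 0 fun x => ?_⟩
  obtain ⟨φ, hφ, rfl⟩ := I.extMk_surjective x _ rfl
  exact (I.extMk_eq_zero_iff φ _ rfl hφ k rfl).2 (h φ hφ)

theorem subsingleton_ext_succ_coproduct [EnoughInjectives 𝒞] {ι : Type*} {W : ι → 𝒞}
    {c : Cofan W} (hc : IsColimit c) (Y : 𝒞) (k : ℕ)
    (h : ∀ j, Subsingleton (Ext (W j) Y (k + 1))) : Subsingleton (Ext c.pt Y (k + 1)) := by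
  have I := injectiveResolution Y
  simp only [subsingleton_ext_succ_iff_injectiveResolution _ I] at h ⊢
  intro φ hφ
  choose ψ hψ using fun j => h j (c.inj j ≫ φ) (by rw [Category.assoc, hφ, comp_zero])
  refine ⟨Cofan.IsColimit.desc hc ψ, Cofan.IsColimit.hom_ext hc _ _ fun j => ?_⟩
  rw [← hψ, Cofan.IsColimit.fac_assoc]

end ExtVanishing

section DirectSum

variable {A : Type u} [Ring A]

theorem exists_finset_sum_lof_component {ι : Type*} [DecidableEq ι] {M : Type*} [AddCommGroup M]
    [Module A M] [Module.Finite A M] {W : ι → Type*} [∀ j, AddCommGroup (W j)]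
    [∀ j, Module A (W j)] (φ : M →ₗ[A] ⨁ j, W j) :
    ∃ F : Finset ι, φ = ∑ j ∈ F, DirectSum.lof A ι W j ∘ₗ DirectSum.component A ι W j ∘ₗ φ := by
  classical
  obtain ⟨G, hG⟩ := Module.Finite.fg_top (R := A) (M := M)
  refine ⟨G.biUnion fun x => (φ x).support, LinearMap.ext_on hG fun x hx => ?_⟩
  have hsub : (φ x).support ⊆ G.biUnion fun x => (φ x).support :=
    Finset.subset_biUnion_of_mem (fun x => (φ x).support) hx
  rw [LinearMap.sum_apply]
  conv_lhs => rw [← DirectSum.sum_support_of (φ x)]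
  refine Finset.sum_subset hsub fun j _ hj => ?_
  rw [DFinsupp.notMem_support_iff.1 hj, map_zero]

theorem subsingleton_ext_succ_directSum {X : ModuleCat.{u} A}
    (hX : HasDegreewiseFiniteResolution X) {ι : Type u} (W : ι → ModuleCat.{u} A) (k : ℕ)
    (h : ∀ j, Subsingleton (Ext X (W j) (k + 1))) :
    Subsingleton (Ext X (ModuleCat.of A (⨁ j, W j)) (k + 1)) := by
  classical
  obtain ⟨P, hP⟩ := hX
  simp only [subsingleton_ext_succ_iff_projectiveResolution P] at h ⊢
  intro φ hφ
  choose ψ hψ using fun j =>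
    h j (φ ≫ ModuleCat.ofHom (DirectSum.component A ι (fun j => W j) j)) (by
      rw [← Category.assoc, hφ, zero_comp])
  obtain ⟨F, hF⟩ := exists_finset_sum_lof_component φ.hom
  refine ⟨∑ j ∈ F, ψ j ≫ ModuleCat.ofHom (DirectSum.lof A ι (fun j => W j) j), ?_⟩
  rw [Preadditive.comp_sum]
  simp only [← Category.assoc, hψ]
  ext1
  rw [ModuleCat.hom_sum, hF]
  simp [LinearMap.comp_assoc]

end DirectSum

section Syzygies

variable {A : Type u} [Ring A]

namespace resolutionImage

variable {X : ModuleCat.{u} A} (P : ProjectiveResolution X)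

/-- The epimorphism `P_k ⟶ Im g_k` through which `g_k` factors. -/
def π : ∀ k, P.complex.X k ⟶ resolutionImage P k
  | 0 => P.π.f 0
  | k + 1 => ModuleCat.ofHom (P.complex.d (k + 1) k).hom.rangeRestrict

/-- The inclusion `Im g_{k+1} ⟶ P_k`. -/
def ι (k : ℕ) : resolutionImage P (k + 1) ⟶ P.complex.X k :=
  ModuleCat.ofHom (LinearMap.range (P.complex.d (k + 1) k).hom).subtype

theorem exact_d_π (k : ℕ) : Function.Exact (P.complex.d (k + 1) k).hom (π P k).hom := by
  cases k with
  | zero => exact (ShortComplex.ShortExact.moduleCat_exact_iff_function_exact _).1 P.exact₀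
  | succ k =>
    exact fun y => Subtype.ext_iff.trans
      ((ShortComplex.ShortExact.moduleCat_exact_iff_function_exact _).1 (P.exact_succ k) y)

theorem π_surjective (k : ℕ) : Function.Surjective (π P k).hom := by
  cases k with
  | zero => exact (ModuleCat.epi_iff_surjective (P.π.f 0)).1 inferInstance
  | succ k => exact LinearMap.surjective_rangeRestrict _

theorem exact_ι_π (k : ℕ) : Function.Exact (ι P k).hom (π P k).hom := by
  rw [← (π_surjective P (k + 1)).comp_exact_iff_exact]
  exact exact_d_π P k

/-- `0 ⟶ Im g_{k+1} ⟶ P_k ⟶ Im g_k ⟶ 0`. -/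
def shortComplex (k : ℕ) : ShortComplex (ModuleCat.{u} A) where
  f := ι P k
  g := π P k
  zero := ModuleCat.hom_ext (exact_ι_π P k).linearMap_comp_eq_zero

theorem shortExact (k : ℕ) : (shortComplex P k).ShortExact :=
  ModuleCat.shortComplex_shortExact _ (exact_ι_π P k) Subtype.val_injective (π_surjective P k)

theorem finite (hP : ∀ i, Module.Finite A (P.complex.X i)) (k : ℕ) :
    Module.Finite A (resolutionImage P k) :=
  have := hP k
  Module.Finite.of_surjective (π P k).hom (π_surjective P k)

theorem subsingleton_ext_add_iff (Y : ModuleCat.{u} A) (k : ℕ) {i : ℕ} (hi : 1 ≤ i) :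
    Subsingleton (Ext X Y (k + i)) ↔ Subsingleton (Ext (resolutionImage P k) Y i) := by
  induction k generalizing i with
  | zero => rw [zero_add]; rfl
  | succ k ih =>
    obtain ⟨i, rfl⟩ := Nat.exists_eq_add_of_le' hi
    rw [add_assoc, add_comm 1, ih (by lia)]
    exact subsingleton_ext_succ_left_iff (shortExact P k) Y (i + 1)
      (Ext.subsingleton_of_projective (P.complex.X k) Y i)
      (Ext.subsingleton_of_projective (P.complex.X k) Y (i + 1))

end resolutionImage

theorem IsDirectSummand.nonempty_retract {W M : ModuleCat.{u} A} (h : IsDirectSummand W M) :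
    Nonempty (Retract W M) := by
  obtain ⟨V, ⟨e⟩⟩ := h
  refine ⟨⟨ModuleCat.ofHom (e.symm.toLinearMap ∘ₗ LinearMap.inl A W V),
    ModuleCat.ofHom (LinearMap.fst A W V ∘ₗ e.toLinearMap), ?_⟩⟩
  ext x
  simp

/- For `i > m`, shifting dimensions to the `m`-th syzygy and back from the summands `W j` exhibits
`Ext^i(X, Y)` as a product of direct summands of groups `Ext^k(X, Y)` with `1 ≤ k < i`. -/
theorem IsUltimatelyClosedAt.subsingleton_ext {X : ModuleCat.{u} A} {P : ProjectiveResolution X}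
    {m : ℕ} (hP : IsUltimatelyClosedAt P m) {Y : ModuleCat.{u} A}
    (h : ∀ i, 1 ≤ i → i ≤ m → Subsingleton (Ext X Y i)) (i : ℕ) (hi : 1 ≤ i) :
    Subsingleton (Ext X Y i) := by
  classical
  induction i using Nat.strong_induction_on with
  | _ i ih =>
    rcases le_or_gt i m with him | him
    · exact h i hi him
    obtain ⟨i, rfl⟩ := Nat.exists_eq_add_of_lt him
    obtain ⟨ι, W, ⟨e⟩, hW⟩ := hP
    have hext_summand : ∀ j, Subsingleton (Ext (W j) Y (i + 1)) := fun j => by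
      obtain ⟨k, hk, hsummand⟩ := hW j
      obtain ⟨r⟩ := hsummand.nonempty_retract
      exact subsingleton_ext_left_of_retract r
        ((resolutionImage.subsingleton_ext_add_iff P Y k (by lia)).1 (ih _ (by lia) (by lia)))
    rw [add_assoc, resolutionImage.subsingleton_ext_add_iff P Y m (by lia)]
    exact subsingleton_ext_left_of_retract (Retract.ofIso e.toModuleIso)
      (subsingleton_ext_succ_coproduct (ModuleCat.coproductCoconeIsColimit W) Y i hext_summand)

end Syzygies

section Characters

variable {A B D : Type*} [AddCommGroup A] [AddCommGroup B] [AddCommGroup D]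

theorem exists_character_of_notMem {H : AddSubgroup B} {b : B} (hb : b ∉ H) :
    ∃ χ : CharacterModule B, (∀ h ∈ H, χ h = 0) ∧ χ b ≠ 0 := by
  have hb' : (b : B ⧸ H) ≠ 0 := by rwa [Ne, QuotientAddGroup.eq_zero_iff]
  obtain ⟨χ, hχ⟩ := CharacterModule.exists_character_apply_ne_zero_of_ne_zero hb'
  exact ⟨CharacterModule.dual (QuotientAddGroup.mk' H).toIntLinearMap χ, fun h hh =>
    (congrArg χ ((QuotientAddGroup.eq_zero_iff h).2 hh)).trans (map_zero χ), hχ⟩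

theorem exists_character_comp_eq (g : B →+ D) (χ : CharacterModule B)
    (hχ : ∀ b, g b = 0 → χ b = 0) : ∃ ψ : CharacterModule D, ∀ b, ψ (g b) = χ b := by
  obtain ⟨ψ, hψ⟩ := CharacterModule.dual_surjective_of_injective
    (QuotientAddGroup.kerLift g).toIntLinearMap (QuotientAddGroup.kerLift_injective g)
    (QuotientAddGroup.lift g.ker χ hχ)
  exact ⟨ψ, fun b => DFunLike.congr_fun hψ (b : B ⧸ g.ker)⟩

theorem exact_iff_exact_characters (f : A →+ B) (g : B →+ D) (hgf : ∀ a, g (f a) = 0) :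
    Function.Exact f g ↔ ∀ χ : CharacterModule B, (∀ a, χ (f a) = 0) →
      ∃ ψ : CharacterModule D, ∀ b, ψ (g b) = χ b := by
  refine ⟨fun h χ hχ => exists_character_comp_eq g χ fun b hb => ?_,
    fun h b => ⟨fun hb => ?_, ?_⟩⟩
  · obtain ⟨a, rfl⟩ := (h b).1 hb
    exact hχ a
  · by_contra hb'
    obtain ⟨χ, hχ, hne⟩ := exists_character_of_notMem (H := f.range) hb'
    obtain ⟨ψ, hψ⟩ := h χ fun a => hχ _ ⟨a, rfl⟩
    exact hne (by rw [← hψ, hb, map_zero])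
  · rintro ⟨a, rfl⟩
    exact hgf a

end Characters

/-- The character module `M⁺ = Hom_ℤ(M, ℚ/ℤ)` of a right or left `S`-module `M`, on which `S` acts
from the other side. -/
def CharacterDual (_S : Type*) (M : Type*) [AddCommGroup M] : Type _ := CharacterModule M

namespace CharacterDual

variable {S M : Type*} [AddCommGroup M]

instance : AddCommGroup (CharacterDual S M) := inferInstanceAs (AddCommGroup (CharacterModule M))

instance : FunLike (CharacterDual S M) M (AddCircle (1 : ℚ)) :=
  inferInstanceAs (FunLike (CharacterModule M) M _)

instance : AddMonoidHomClass (CharacterDual S M) M (AddCircle (1 : ℚ)) where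
  map_add := AddMonoidHom.map_add
  map_zero := AddMonoidHom.map_zero

theorem ext {χ χ' : CharacterDual S M} (h : ∀ c, χ c = χ' c) : χ = χ' :=
  DFunLike.ext _ _ h

theorem add_apply (χ χ' : CharacterDual S M) (c : M) : (χ + χ') c = χ c + χ' c := rfl

theorem zero_apply (c : M) : (0 : CharacterDual S M) c = 0 := rfl

variable [Ring S]

instance [Module Sᵐᵒᵖ M] : Module S (CharacterDual S M) where
  smul s χ := AddMonoidHom.comp χ (DistribSMul.toAddMonoidHom M (MulOpposite.op s))
  one_smul χ := ext fun c => congrArg χ (one_smul _ c)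
  mul_smul s t χ := ext fun c => congrArg χ (mul_smul (MulOpposite.op t) (MulOpposite.op s) c)
  smul_zero _ := rfl
  smul_add _ _ _ := rfl
  add_smul s t χ := ext fun c =>
    (congrArg χ (add_smul (MulOpposite.op s) (MulOpposite.op t) c)).trans (map_add χ _ _)
  zero_smul χ := ext fun c => (congrArg χ (zero_smul Sᵐᵒᵖ c)).trans (map_zero χ)

instance [Module S M] : Module Sᵐᵒᵖ (CharacterDual S M) where
  smul s χ := AddMonoidHom.comp χ (DistribSMul.toAddMonoidHom M s.unop)
  one_smul χ := ext fun c => congrArg χ (one_smul _ c)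
  mul_smul s t χ := ext fun c => congrArg χ (mul_smul t.unop s.unop c)
  smul_zero _ := rfl
  smul_add _ _ _ := rfl
  add_smul s t χ := ext fun c => (congrArg χ (add_smul s.unop t.unop c)).trans (map_add χ _ _)
  zero_smul χ := ext fun c => (congrArg χ (zero_smul S c)).trans (map_zero χ)

end CharacterDual

section BalancedTensor

variable {R S : Type u} [Ring R] [Ring S] {C : Type u} [AddCommGroup C] [Module R C]
  [Module Sᵐᵒᵖ C] {N : Type u} [AddCommGroup N] [Module S N]

theorem balancedTensor_induction {p : BalancedTensor R S C N → Prop} (t : BalancedTensor R S C N)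
    (zero : p 0) (tmul : ∀ c x, p (tmul R S c x)) (add : ∀ a b, p a → p b → p (a + b)) : p t := by
  obtain ⟨t, rfl⟩ := Submodule.mkQ_surjective _ t
  induction t using TensorProduct.induction_on with
  | zero => rwa [map_zero]
  | tmul c x => exact tmul c x
  | add a b ha hb => rw [map_add]; exact add _ _ ha hb

theorem balancedTensor_character_ext {χ χ' : CharacterModule (BalancedTensor R S C N)}
    (h : ∀ c x, χ (tmul R S c x) = χ' (tmul R S c x)) : χ = χ' := by
  ext t
  induction t using balancedTensor_induction with
  | zero => rw [map_zero, map_zero]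
  | tmul c x => exact h c x
  | add a b ha hb => rw [map_add, map_add, ha, hb]

theorem tmul_add_left (c c' : C) (x : N) :
    tmul R S (c + c') x = tmul R S c x + tmul R S c' x := by
  rw [tmul, TensorProduct.add_tmul, map_add, tmul, tmul]

theorem tmul_add_right (c : C) (x x' : N) :
    tmul R S c (x + x') = tmul R S c x + tmul R S c x' := by
  rw [tmul, TensorProduct.tmul_add, map_add, tmul, tmul]

theorem op_smul_tmul (s : S) (c : C) (x : N) :
    tmul R S (MulOpposite.op s • c) x = tmul R S c (s • x) := by
  rw [← sub_eq_zero, tmul, tmul, ← map_sub, Submodule.mkQ_apply, Submodule.Quotient.mk_eq_zero]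
  exact Submodule.subset_span ⟨c, s, x, rfl⟩

/-- The homomorphism `N → C⁺` corresponding to a character of `C ⊗[S] N`. -/
def characterCurry (χ : CharacterModule (BalancedTensor R S C N)) : N →ₗ[S] CharacterDual S C where
  toFun x := AddMonoidHom.mk' (fun c => χ (tmul R S c x)) fun c c' => by
    rw [tmul_add_left, map_add]
  map_add' x x' := CharacterDual.ext fun c =>
    (congrArg χ (tmul_add_right c x x')).trans (map_add χ _ _)
  map_smul' s x := CharacterDual.ext fun c => (congrArg χ (op_smul_tmul s c x)).symm

theorem characterCurry_bijective [SMulCommClass R Sᵐᵒᵖ C] :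
    Function.Bijective (characterCurry (R := R) (S := S) (C := C) (N := N)) := by
  refine ⟨fun χ χ' h => balancedTensor_character_ext fun c x =>
    DFunLike.congr_fun (LinearMap.congr_fun h x) c, fun φ => ?_⟩
  let χ₀ : C ⊗[ℤ] N →+ AddCircle (1 : ℚ) :=
    TensorProduct.liftAddHom (AddMonoidHom.flip (φ.toAddMonoidHom : N →+ C →+ AddCircle (1 : ℚ)))
      fun n c x => by
        change φ x (n • c) = φ (n • x) c
        rw [map_zsmul, map_zsmul]
        rfl
  have hχ₀ : ∀ t ∈ balancedRelations R S C N, χ₀ t = 0 := fun t ht => by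
    induction ht using Submodule.closure_induction with
    | zero => exact map_zero χ₀
    | add a b _ _ ha hb => rw [map_add, ha, hb, add_zero]
    | smul_mem r t ht =>
      obtain ⟨c, s, x, rfl⟩ := ht
      rw [smul_sub, TensorProduct.smul_tmul', TensorProduct.smul_tmul', map_sub,
        smul_comm r (MulOpposite.op s) c, sub_eq_zero]
      change φ x (MulOpposite.op s • r • c) = φ (s • x) (r • c)
      exact (DFunLike.congr_fun (map_smul φ s x) (r • c)).symm
  exact ⟨QuotientAddGroup.lift (balancedRelations R S C N).toAddSubgroup χ₀ hχ₀, rfl⟩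

variable {K P : Type u} [AddCommGroup K] [AddCommGroup P] [Module S K] [Module S P]

theorem characterCurry_comp_eq_iff {f : K →ₗ[S] P} {χ : CharacterModule (BalancedTensor R S C P)}
    {ψ : CharacterModule (BalancedTensor R S C K)} :
    characterCurry χ ∘ₗ f = characterCurry ψ ↔ ∀ t, χ (tensorMap R S C f t) = ψ t := by
  refine ⟨fun h t => ?_, fun h => LinearMap.ext fun x => CharacterDual.ext fun c => ?_⟩
  · induction t using balancedTensor_induction with
    | zero => rw [map_zero, map_zero, map_zero]
    | tmul c x =>
      rw [tensorMap_tmul]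
      exact DFunLike.congr_fun (LinearMap.congr_fun h x) c
    | add a b ha hb => rw [map_add, map_add, map_add, ha, hb]
  · exact (congrArg χ (tensorMap_tmul R C f c x)).symm.trans (h _)

theorem tensorMap_surjective (g : P →ₗ[S] N) (hg : Function.Surjective g) :
    Function.Surjective (tensorMap R S C g) := by
  intro t
  induction t using balancedTensor_induction with
  | zero => exact ⟨0, map_zero _⟩
  | tmul c x =>
    obtain ⟨p, rfl⟩ := hg x
    exact ⟨tmul R S c p, tensorMap_tmul R C g c p⟩
  | add a b ha hb =>
    obtain ⟨a, rfl⟩ := ha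
    obtain ⟨b, rfl⟩ := hb
    exact ⟨a + b, map_add _ _ _⟩

end BalancedTensor

section Tor

variable (R : Type u) {S : Type u} [Ring R] [Ring S] (C : Type u) [AddCommGroup C] [Module R C]
  [Module Sᵐᵒᵖ C] [SMulCommClass R Sᵐᵒᵖ C]

/- `(C ⊗[S] N)⁺ ≃ Hom_S(N, C⁺)`, and `ℚ/ℤ` detects exactness. -/
theorem exact_tensorFunctor_iff (T : ShortComplex (ModuleCat.{u} S)) :
    (T.map (tensorFunctor R S C)).Exact ↔
      ∀ φ : T.X₂ ⟶ ModuleCat.of S (CharacterDual S C), T.f ≫ φ = 0 → ∃ ψ, T.g ≫ ψ = φ := by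
  have hchar := exact_iff_exact_characters (tensorMap R S C T.f.hom).toAddMonoidHom
    (tensorMap R S C T.g.hom).toAddMonoidHom fun t =>
      LinearMap.congr_fun (congrArg ModuleCat.Hom.hom (T.map (tensorFunctor R S C)).zero) t
  rw [ShortComplex.ShortExact.moduleCat_exact_iff_function_exact]
  refine hchar.trans ⟨fun h φ hφ => ?_, fun h χ hχ => ?_⟩
  · obtain ⟨χ, hχ⟩ := (characterCurry_bijective (R := R)).surjective φ.hom
    obtain ⟨ψ, hψ⟩ := h χ (characterCurry_comp_eq_iff (ψ := 0).1 (by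
      rw [hχ]; exact congrArg ModuleCat.Hom.hom hφ))
    exact ⟨ModuleCat.ofHom (characterCurry ψ),
      ModuleCat.hom_ext ((characterCurry_comp_eq_iff.2 hψ).trans hχ)⟩
  · obtain ⟨ψ', hψ'⟩ := h (ModuleCat.ofHom (characterCurry χ))
      (ModuleCat.hom_ext (characterCurry_comp_eq_iff (ψ := 0).2 hχ))
    obtain ⟨ψ, hψ⟩ := (characterCurry_bijective (R := R)).surjective ψ'.hom
    refine ⟨ψ, characterCurry_comp_eq_iff.1 ?_⟩
    rw [hψ]
    exact congrArg ModuleCat.Hom.hom hψ'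

theorem isZero_bimoduleTor_iff (N : ModuleCat.{u} S) {i : ℕ} (hi : 1 ≤ i) :
    IsZero (bimoduleTor R S C i N) ↔
      Subsingleton (Ext N (ModuleCat.of S (CharacterDual S C)) i) := by
  obtain ⟨k, rfl⟩ := Nat.exists_eq_add_of_le' hi
  have P := projectiveResolution N
  rw [subsingleton_ext_succ_iff_projectiveResolution P]
  refine (P.isoLeftDerivedObj (tensorFunctor R S C) (k + 1)).isZero_iff.trans ?_
  refine (HomologicalComplex.exactAt_iff_isZero_homology _ _).symm.trans ?_
  rw [HomologicalComplex.exactAt_iff' _ (k + 2) (k + 1) k (by simp) (by simp)]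
  exact exact_tensorFunctor_iff R C (P.complex.sc' (k + 2) (k + 1) k)

variable {R C} in
theorem shortExact_tensorFunctor {T : ShortComplex (ModuleCat.{u} S)} (hT : T.ShortExact)
    (hTor : IsZero (bimoduleTor R S C 1 T.X₃)) :
    (T.map (tensorFunctor R S C)).ShortExact := by
  have := hT.epi_g
  have hext := (isZero_bimoduleTor_iff R C T.X₃ le_rfl).1 hTor
  let S₀ : ShortComplex (ModuleCat.{u} S) := ⟨(0 : T.X₁ ⟶ T.X₁), T.f, zero_comp⟩
  have hmono : (S₀.map (tensorFunctor R S C)).Exact :=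
    (exact_tensorFunctor_iff R C S₀).2 fun φ _ => exists_extension_of_subsingleton_ext_one hT hext φ
  exact
    { exact := (exact_tensorFunctor_iff R C T).2 fun φ hφ =>
        ⟨hT.exact.desc φ hφ, hT.exact.g_desc φ hφ⟩
      mono_f := (ShortComplex.exact_iff_mono _ ((tensorFunctor R S C).map_zero _ _)).1 hmono
      epi_g := (ModuleCat.epi_iff_surjective _).2
        (tensorMap_surjective T.g.hom ((ModuleCat.epi_iff_surjective _).1 hT.epi_g)) }

end Tor

section CharacterDualMap

variable {S : Type u} [Ring S]

/-- The map `D⁺ → C⁺` induced by a homomorphism `C → D` of right `S`-modules. -/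
def CharacterDual.map {C D : Type*} [AddCommGroup C] [AddCommGroup D] [Module Sᵐᵒᵖ C]
    [Module Sᵐᵒᵖ D] (f : C →ₗ[Sᵐᵒᵖ] D) : CharacterDual S D →ₗ[S] CharacterDual S C where
  toFun χ := AddMonoidHom.comp χ f.toAddMonoidHom
  map_add' _ _ := rfl
  map_smul' s χ := CharacterDual.ext fun c => congrArg χ (f.map_smul (MulOpposite.op s) c).symm

/-- The map `B⁺ → A⁺` induced by a homomorphism `A → B` of left `S`-modules. -/
def CharacterDual.mapOp {A B : Type*} [AddCommGroup A] [AddCommGroup B] [Module S A] [Module S B]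
    (f : A →ₗ[S] B) : CharacterDual S B →ₗ[Sᵐᵒᵖ] CharacterDual S A where
  toFun χ := AddMonoidHom.comp χ f.toAddMonoidHom
  map_add' _ _ := rfl
  map_smul' s χ := CharacterDual.ext fun a => congrArg χ (f.map_smul s.unop a).symm

theorem CharacterDual.map_surjective {C D : Type*} [AddCommGroup C] [AddCommGroup D]
    [Module Sᵐᵒᵖ C] [Module Sᵐᵒᵖ D] {f : C →ₗ[Sᵐᵒᵖ] D} (hf : Function.Injective f) :
    Function.Surjective (CharacterDual.map f) :=
  CharacterModule.dual_surjective_of_injective f.toAddMonoidHom.toIntLinearMap hf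

theorem CharacterDual.mapOp_surjective {A B : Type*} [AddCommGroup A] [AddCommGroup B] [Module S A]
    [Module S B] {f : A →ₗ[S] B} (hf : Function.Injective f) :
    Function.Surjective (CharacterDual.mapOp f) :=
  CharacterModule.dual_surjective_of_injective f.toAddMonoidHom.toIntLinearMap hf

/-- The natural bijection `Hom_S(A, F⁺) ≃ Hom_{Sᵒᵖ}(F, A⁺)`: both sides are the balanced pairings of
the right `S`-module `F` and the left `S`-module `A` with values in `ℚ/ℤ`. -/
def CharacterDual.flip {A F : Type*} [AddCommGroup A] [AddCommGroup F] [Module S A]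
    [Module Sᵐᵒᵖ F] : (A →ₗ[S] CharacterDual S F) ≃ (F →ₗ[Sᵐᵒᵖ] CharacterDual S A) where
  toFun φ :=
    { toFun y := AddMonoidHom.mk' (fun a => φ a y) fun a b => by rw [map_add, add_apply]
      map_add' y z := CharacterDual.ext fun a => map_add (φ a) y z
      map_smul' s y := CharacterDual.ext fun a =>
        (DFunLike.congr_fun (φ.map_smul s.unop a) y).symm }
  invFun φ :=
    { toFun a := AddMonoidHom.mk' (fun y => φ y a) fun y z => by rw [map_add, add_apply]
      map_add' a b := CharacterDual.ext fun y => map_add (φ y) a b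
      map_smul' s a := CharacterDual.ext fun y =>
        (DFunLike.congr_fun (φ.map_smul (MulOpposite.op s) y) a).symm }

theorem injective_characterDual (F : ModuleCat.{u} Sᵐᵒᵖ) [Projective F] :
    Injective (ModuleCat.of S (CharacterDual S F)) where
  factors {A B} φ j hj := by
    have hF : Module.Projective Sᵐᵒᵖ F := (IsProjective.iff_projective F).2 inferInstance
    obtain ⟨ψ, hψ⟩ := Module.projective_lifting_property (CharacterDual.mapOp j.hom)
      (CharacterDual.flip φ.hom)
      (CharacterDual.mapOp_surjective ((ModuleCat.mono_iff_injective j).1 hj))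
    exact ⟨ModuleCat.ofHom (CharacterDual.flip.symm ψ), ModuleCat.hom_ext <| LinearMap.ext fun a =>
      CharacterDual.ext (S := S) fun y => DFunLike.congr_fun (LinearMap.congr_fun hψ y) a⟩

/-- The sequence `0 ⟶ T₃⁺ ⟶ T₂⁺ ⟶ T₁⁺ ⟶ 0` of left `S`-modules dual to a sequence `T` of right
`S`-modules. -/
def characterDualComplex (T : ShortComplex (ModuleCat.{u} Sᵐᵒᵖ)) :
    ShortComplex (ModuleCat.{u} S) where
  X₁ := ModuleCat.of S (CharacterDual S T.X₃)
  X₂ := ModuleCat.of S (CharacterDual S T.X₂)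
  X₃ := ModuleCat.of S (CharacterDual S T.X₁)
  f := ModuleCat.ofHom (CharacterDual.map T.g.hom)
  g := ModuleCat.ofHom (CharacterDual.map T.f.hom)
  zero := ModuleCat.hom_ext <| LinearMap.ext fun χ => CharacterDual.ext (S := S) fun x =>
    (congrArg χ (LinearMap.congr_fun (congrArg ModuleCat.Hom.hom T.zero) x)).trans
      (map_zero (F := CharacterDual S T.X₃) χ)

theorem shortExact_characterDualComplex {T : ShortComplex (ModuleCat.{u} Sᵐᵒᵖ)}
    (hT : T.ShortExact) : (characterDualComplex T).ShortExact where
  exact := by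
    refine (ShortComplex.ShortExact.moduleCat_exact_iff_function_exact _).2 fun χ =>
      ⟨fun hχ => ?_, ?_⟩
    · obtain ⟨ψ, hψ⟩ := (exact_iff_exact_characters T.f.hom.toAddMonoidHom T.g.hom.toAddMonoidHom
        fun x => T.moduleCat_zero_apply x).1
        ((ShortComplex.ShortExact.moduleCat_exact_iff_function_exact T).1 hT.exact) χ
        fun x => DFunLike.congr_fun (F := CharacterDual S T.X₁) hχ x
      exact ⟨ψ, CharacterDual.ext (S := S) hψ⟩
    · rintro ⟨ψ, rfl⟩
      exact (characterDualComplex T).moduleCat_zero_apply ψ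
  mono_f := (ModuleCat.mono_iff_injective _).2 fun χ χ' h =>
    CharacterDual.ext (S := S) fun x => by
      obtain ⟨y, rfl⟩ := hT.moduleCat_surjective_g x
      exact DFunLike.congr_fun (F := CharacterDual S T.X₂) h y
  epi_g := (ModuleCat.epi_iff_surjective _).2
    (CharacterDual.map_surjective hT.moduleCat_injective_f)

end CharacterDualMap

section Villamayor

/- Villamayor's criterion: a section of `f⁺` makes every solution in `F` of a linear system with
right-hand side in `f(K)` solvable in `K`, so that `f` has a retraction at each single element, and
these combine to a retraction of `f` when `K` is finitely generated. -/
theorem exists_sum_smul_of_characterDual_section {S : Type*} [Ring S] {K F : Type*}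
    [AddCommGroup K] [AddCommGroup F] [Module Sᵐᵒᵖ K] [Module Sᵐᵒᵖ F] {f : K →ₗ[Sᵐᵒᵖ] F}
    {σ : CharacterDual S K →ₗ[S] CharacterDual S F} (hσ : ∀ χ u, σ χ (f u) = χ u)
    {ι : Type*} (E : Finset ι) (s : ι → Sᵐᵒᵖ) (y : ι → F) {u : K}
    (hu : f u = ∑ e ∈ E, s e • y e) : ∃ k : ι → K, u = ∑ e ∈ E, s e • k e := by
  classical
  let H : AddSubgroup K :=
    (∑ e ∈ E, (DistribSMul.toAddMonoidHom K (s e)).comp (Pi.evalAddMonoidHom _ e)).range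
  by_contra hH
  obtain ⟨χ, hχ, hne⟩ : ∃ χ : CharacterDual S K, (∀ k ∈ H, χ k = 0) ∧ χ u ≠ 0 :=
    exists_character_of_notMem fun ⟨k, hk⟩ => hH ⟨k, by simpa using hk.symm⟩
  have hsmul : ∀ e ∈ E, (s e).unop • χ = 0 := fun e he =>
    CharacterDual.ext fun k => hχ (s e • k) ⟨Pi.single e k, by simp [Pi.single_apply, he]⟩
  refine hne ?_
  calc χ u = σ χ (f u) := (hσ χ u).symm
    _ = ∑ e ∈ E, ((s e).unop • σ χ) (y e) := by rw [hu, map_sum]; rfl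
    _ = 0 := Finset.sum_eq_zero fun e he => by
      rw [← map_smul, hsmul e he, map_zero, CharacterDual.zero_apply]

theorem exists_hom_apply_eq_of_characterDual_section {S : Type*} [Ring S] {K F : Type*}
    [AddCommGroup K] [AddCommGroup F] [Module Sᵐᵒᵖ K] [Module Sᵐᵒᵖ F] [Module.Projective Sᵐᵒᵖ F]
    {f : K →ₗ[Sᵐᵒᵖ] F} {σ : CharacterDual S K →ₗ[S] CharacterDual S F}
    (hσ : ∀ χ u, σ χ (f u) = χ u) (u : K) : ∃ θ : F →ₗ[Sᵐᵒᵖ] K, θ (f u) = u := by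
  obtain ⟨s, hs⟩ := Module.Projective.out (R := Sᵐᵒᵖ) (P := F)
  obtain ⟨k, hk⟩ := exists_sum_smul_of_characterDual_section hσ (s (f u)).support (s (f u)) id
    ((hs (f u)).symm.trans (Finsupp.linearCombination_apply ..))
  exact ⟨Finsupp.linearCombination Sᵐᵒᵖ k ∘ₗ s, hk.symm⟩

theorem exists_retraction_of_forall_exists_hom {A : Type*} [Ring A] {K F : Type*} [AddCommGroup K]
    [AddCommGroup F] [Module A K] [Module A F] [Module.Finite A K] {f : K →ₗ[A] F}
    (hf : ∀ u, ∃ θ : F →ₗ[A] K, θ (f u) = u) : ∃ θ : F →ₗ[A] K, θ ∘ₗ f = LinearMap.id := by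
  classical
  suffices H : ∀ t : Finset K, ∃ θ : F →ₗ[A] K, ∀ u ∈ t, θ (f u) = u by
    obtain ⟨t, ht⟩ := Module.Finite.fg_top (R := A) (M := K)
    obtain ⟨θ, hθ⟩ := H t
    exact ⟨θ, LinearMap.ext_on ht hθ⟩
  intro t
  induction t using Finset.induction_on with
  | empty => exact ⟨0, by simp⟩
  | insert u t _ ih =>
    obtain ⟨θ, hθ⟩ := ih
    obtain ⟨θ', hθ'⟩ := hf (u - θ (f u))
    refine ⟨θ + θ' ∘ₗ (LinearMap.id - f ∘ₗ θ), Finset.forall_mem_insert _ _ _ |>.2 ⟨?_, ?_⟩⟩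
    · calc θ (f u) + θ' (f u - f (θ (f u))) = θ (f u) + θ' (f (u - θ (f u))) := by rw [map_sub f]
        _ = u := by rw [hθ', add_sub_cancel]
    · intro w hw
      simp [hθ w hw]

theorem projective_X₃_of_injective_characterDual {S : Type u} [Ring S]
    {T : ShortComplex (ModuleCat.{u} Sᵐᵒᵖ)} (hT : T.ShortExact) [Projective T.X₂]
    [Module.Finite Sᵐᵒᵖ T.X₁] (hX : Injective (ModuleCat.of S (CharacterDual S T.X₃))) :
    Projective T.X₃ := by
  have hF : Module.Projective Sᵐᵒᵖ T.X₂ := (IsProjective.iff_projective T.X₂).2 inferInstance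
  have : Injective (characterDualComplex T).X₁ := hX
  have hσ := (shortExact_characterDualComplex hT).splittingOfInjective.s_g
  obtain ⟨θ, hθ⟩ := exists_retraction_of_forall_exists_hom
    (exists_hom_apply_eq_of_characterDual_section fun χ u =>
      DFunLike.congr_fun (F := CharacterDual S T.X₁)
        (LinearMap.congr_fun (congrArg ModuleCat.Hom.hom hσ) χ) u)
  have := hT.epi_g
  let splitting := ShortComplex.Splitting.ofExactOfRetraction T hT.exact (ModuleCat.ofHom θ)
    (ModuleCat.hom_ext hθ) inferInstance
  exact Retract.projective ⟨splitting.s, T.g, splitting.s_g⟩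

theorem hasInjectiveDimensionLT_characterDual_iff {S : Type u} [Ring S] {X : ModuleCat.{u} Sᵐᵒᵖ}
    (P : ProjectiveResolution X) (hP : ∀ i, Module.Finite Sᵐᵒᵖ (P.complex.X i)) (n k : ℕ) :
    HasInjectiveDimensionLT (ModuleCat.of S (CharacterDual S (resolutionImage P k))) (n + 1) ↔
      HasProjectiveDimensionLT (resolutionImage P k) (n + 1) := by
  have hT := resolutionImage.shortExact P
  have (k : ℕ) : Projective (resolutionImage.shortComplex P k).X₂ := P.projective k
  induction n generalizing k with
  | zero =>
    rw [zero_add, ← injective_iff_hasInjectiveDimensionLT_one,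
      ← projective_iff_hasProjectiveDimensionLT_one]
    have : Module.Finite Sᵐᵒᵖ (resolutionImage.shortComplex P k).X₁ :=
      resolutionImage.finite P hP (k + 1)
    exact ⟨projective_X₃_of_injective_characterDual (hT k), fun _ => injective_characterDual _⟩
  | succ n ih =>
    exact ((shortExact_characterDualComplex (hT k)).hasInjectiveDimensionLT_X₃_iff n
      (injective_characterDual _)).symm.trans <| (ih (k + 1)).trans
        ((hT k).hasProjectiveDimensionLT_X₃_iff n (P.projective k)).symm

theorem forall_isZero_bimoduleTor_succ_iff {R S : Type u} [Ring R] [Ring S] {C : Type u}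
    [AddCommGroup C] [Module R C] [Module Sᵐᵒᵖ C] [SMulCommClass R Sᵐᵒᵖ C]
    (hC : HasDegreewiseFiniteResolution (ModuleCat.of Sᵐᵒᵖ C)) (n : ℕ) :
    (∀ N, IsZero (bimoduleTor R S C (n + 1) N)) ↔
      projectiveDimension (ModuleCat.of Sᵐᵒᵖ C) ≤ n := by
  obtain ⟨P, hP⟩ := hC
  rw [projectiveDimension_le_iff]
  refine Iff.trans ?_ (hasInjectiveDimensionLT_characterDual_iff P hP n 0)
  refine (forall_congr' fun N => isZero_bimoduleTor_iff R C N (by lia)).trans ?_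
  exact ⟨fun h => hasInjectiveDimensionLT_of_enoughProjectives _ _ fun N => h N,
    fun h N => HasInjectiveDimensionLT.subsingleton (hX := h) _ _ _ le_rfl N⟩

end Villamayor

/-- The conditions of a semidualizing `(R, S)`-bimodule `C` that concern the left `R`-module `C`:
`C` has a degreewise finite projective resolution and no self-extensions, and `S` is its
endomorphism ring. -/
structure IsLeftSemidualizing (R S : Type u) [Ring R] [Ring S] (C : Type u) [AddCommGroup C]
    [Module R C] [Module Sᵐᵒᵖ C] [SMulCommClass R Sᵐᵒᵖ C] : Prop where
  finite_left : HasDegreewiseFiniteResolution (ModuleCat.of R C)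
  homothety_right : haveI := SMulCommClass.symm R Sᵐᵒᵖ C
    Function.Bijective
      (fun s : S => (Module.toModuleEnd R (S := Sᵐᵒᵖ) C (MulOpposite.op s) : C →ₗ[R] C))
  ext_left : ∀ i : ℕ, 1 ≤ i →
    Subsingleton (Ext (ModuleCat.of R C) (ModuleCat.of R C) i)

theorem IsSemidualizing.isLeftSemidualizing {R S : Type u} [Ring R] [Ring S] {C : Type u}
    [AddCommGroup C] [Module R C] [Module Sᵐᵒᵖ C] [SMulCommClass R Sᵐᵒᵖ C]
    (hC : IsSemidualizing R S C) : IsLeftSemidualizing R S C where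
  finite_left := hC.finite_left
  homothety_right := hC.homothety_right
  ext_left := hC.ext_left

theorem HasDegreewiseFiniteResolution.finite {A : Type u} [Ring A] {X : ModuleCat.{u} A}
    (hX : HasDegreewiseFiniteResolution X) : Module.Finite A X := by
  obtain ⟨P, hP⟩ := hX
  exact resolutionImage.finite P hP 0

section Valuation

variable {R S : Type u} [Ring R] [Ring S] {C : Type u} [AddCommGroup C] [Module R C]
  [Module Sᵐᵒᵖ C]

theorem valuation_map {N N' : Type u} [AddCommGroup N] [Module S N] [AddCommGroup N']
    [Module S N'] (f : N →ₗ[S] N') (x : N) :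
    valuation R S C N' (f x) = tensorMap R S C f ∘ₗ valuation R S C N x :=
  LinearMap.ext fun c => (tensorMap_tmul R C f c x).symm

/-- The `R`-linear map `C ⊗[S] N → X`, `c ⊗ x ↦ φ(x)(c)`, induced by a balanced additive map
`φ : N → Hom_R(C, X)`. -/
def balancedLift {N X : Type u} [AddCommGroup N] [Module S N] [AddCommGroup X] [Module R X]
    (φ : N →+ (C →ₗ[R] X)) (hφ : ∀ (s : S) x c, φ x (MulOpposite.op s • c) = φ (s • x) c) :
    BalancedTensor R S C N →ₗ[R] X :=
  (balancedRelations R S C N).liftQ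
    (TensorProduct.AlgebraTensorModule.lift φ.toIntLinearMap.flip) (by
      rw [balancedRelations, Submodule.span_le]
      rintro _ ⟨c, s, x, rfl⟩
      rw [SetLike.mem_coe, LinearMap.mem_ker, map_sub, sub_eq_zero]
      exact hφ s x c)

variable (R S C) in
/-- `C ⊗[S] S ≃ C`. -/
def tensorRid [SMulCommClass R Sᵐᵒᵖ C] : BalancedTensor R S C S ≃ₗ[R] C :=
  haveI := SMulCommClass.symm R Sᵐᵒᵖ C
  LinearEquiv.ofLinearMap
    (balancedLift ((Module.toModuleEnd R (S := Sᵐᵒᵖ) C).toAddMonoidHom.comp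
      (MulOpposite.opAddEquiv : S ≃+ Sᵐᵒᵖ).toAddMonoidHom) fun s t c =>
        (mul_smul (MulOpposite.op t) (MulOpposite.op s) c).symm)
    (valuation R S C S 1)
    (LinearMap.ext fun c => one_smul Sᵐᵒᵖ c)
    (balancedTensor_hom_ext fun c s =>
      (op_smul_tmul s c 1).trans (congrArg _ (mul_one s)))

section DirectSum

variable {J : Type u} {N : J → Type u} [∀ j, AddCommGroup (N j)] [∀ j, Module S (N j)]

section TensorDirectSum

variable [DecidableEq J]

variable (R S C N) in
/-- The map `x ↦ (c ↦ (c ⊗ x_j)_j)`. -/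
def valuationDirectSum : (⨁ j, N j) →+ (C →ₗ[R] ⨁ j, BalancedTensor R S C (N j)) :=
  DirectSum.toAddMonoid fun j =>
    (LinearMap.compRight ℤ (DirectSum.lof R J _ j)).toAddMonoidHom.comp (valuation R S C (N j))

theorem valuationDirectSum_lof (j : J) (x : N j) (c : C) :
    valuationDirectSum R S C N (DirectSum.lof S J N j x) c =
      DirectSum.lof R J (fun j => BalancedTensor R S C (N j)) j (tmul R S c x) := by
  rw [valuationDirectSum, DirectSum.lof_eq_of, DirectSum.toAddMonoid_of]
  rfl

theorem valuationDirectSum_op_smul (s : S) (x : ⨁ j, N j) (c : C) :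
    valuationDirectSum R S C N x (MulOpposite.op s • c) =
      valuationDirectSum R S C N (s • x) c := by
  induction x using DirectSum.induction_on with
  | zero => rw [smul_zero, map_zero, LinearMap.zero_apply, LinearMap.zero_apply]
  | of j x =>
    rw [← DirectSum.lof_eq_of S, ← map_smul, valuationDirectSum_lof, valuationDirectSum_lof,
      op_smul_tmul]
  | add x y hx hy =>
    rw [smul_add, map_add, map_add, LinearMap.add_apply, LinearMap.add_apply, hx, hy]

theorem toModule_valuationDirectSum (x : ⨁ j, N j) (c : C) :
    DirectSum.toModule R J _ (fun j => tensorMap R S C (DirectSum.lof S J N j))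
      (valuationDirectSum R S C N x c) = tmul R S c x := by
  change _ = valuation R S C _ x c
  induction x using DirectSum.induction_on with
  | zero => rw [map_zero, map_zero, LinearMap.zero_apply, LinearMap.zero_apply, map_zero]
  | of j x =>
    rw [← DirectSum.lof_eq_of S, valuationDirectSum_lof, DirectSum.toModule_lof, tensorMap_tmul]
    rfl
  | add x y hx hy =>
    rw [map_add, map_add, LinearMap.add_apply, LinearMap.add_apply, map_add, hx, hy]

variable (R S C N) in
/-- `C ⊗[S] (⨁ N_j) ≃ ⨁ C ⊗[S] N_j`. -/
def tensorDirectSum :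
    BalancedTensor R S C (⨁ j, N j) ≃ₗ[R] ⨁ j, BalancedTensor R S C (N j) :=
  LinearEquiv.ofLinearMap
    (balancedLift (N := ⨁ j, N j) (X := ⨁ j, BalancedTensor R S C (N j))
      (valuationDirectSum R S C N) valuationDirectSum_op_smul)
    (DirectSum.toModule R J _ fun j => tensorMap R S C (DirectSum.lof S J N j))
    (DirectSum.linearMap_ext R fun j =>
      balancedTensor_hom_ext (S := S) (X := ⨁ j, BalancedTensor R S C (N j)) fun c x => by
        rw [LinearMap.comp_apply, LinearMap.comp_apply, DirectSum.toModule_lof, tensorMap_tmul]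
        exact valuationDirectSum_lof j x c)
    (balancedTensor_hom_ext fun c x => toModule_valuationDirectSum x c)

end TensorDirectSum

theorem valuation_directSum_bijective [Module.Finite R C]
    (h : ∀ j, Function.Bijective (valuation R S C (N j))) :
    Function.Bijective (valuation R S C (⨁ j, N j)) := by
  classical
  refine ⟨fun x y hxy => ?_, fun φ => ?_⟩
  · refine DFinsupp.ext fun j => (h j).injective ?_
    change valuation R S C (N j) (DirectSum.component S J N j x) =
      valuation R S C (N j) (DirectSum.component S J N j y)
    rw [valuation_map, hxy, ← valuation_map]
  · obtain ⟨F, hF⟩ := exists_finset_sum_lof_component ((tensorDirectSum R S C N).toLinearMap ∘ₗ φ)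
    choose x hx using fun j => (h j).surjective (DirectSum.component R J _ j ∘ₗ
      (tensorDirectSum R S C N).toLinearMap ∘ₗ φ)
    refine ⟨∑ j ∈ F, DirectSum.lof S J N j (x j), LinearMap.ext fun c =>
      (tensorDirectSum R S C N).injective ((LinearMap.congr_fun hF c).trans ?_).symm⟩
    change _ = valuationDirectSum R S C N (∑ j ∈ F, DirectSum.lof S J N j (x j)) c
    rw [map_sum, LinearMap.sum_apply, LinearMap.sum_apply]
    refine Finset.sum_congr rfl fun j _ => ?_
    rw [valuationDirectSum_lof, LinearMap.comp_apply, ← hx]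
    rfl

end DirectSum

end Valuation

section Auslander

variable {R S : Type u} [Ring R] [Ring S] {C : Type u} [AddCommGroup C] [Module R C]
  [Module Sᵐᵒᵖ C] [SMulCommClass R Sᵐᵒᵖ C]

theorem auslanderClass.of_retract {N N' : ModuleCat.{u} S} (r : Retract N N')
    (hN' : auslanderClass R S C N') : auslanderClass R S C N where
  tor_eq_zero i hi := (isZero_bimoduleTor_iff R C N hi).2 <|
    subsingleton_ext_left_of_retract r <|
      (isZero_bimoduleTor_iff R C N' hi).1 (hN'.tor_eq_zero i hi)
  ext_eq_zero i hi :=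
    subsingleton_ext_right_of_retract (r.map (tensorFunctor R S C)) (hN'.ext_eq_zero i hi)
  valuation_bijective := by
    have hr : ∀ x, r.r (r.i x) = x := fun x =>
      LinearMap.congr_fun (congrArg ModuleCat.Hom.hom r.retract) x
    refine ⟨fun x y hxy => ?_, fun φ => ?_⟩
    · rw [← hr x, ← hr y]
      refine congrArg _ (hN'.valuation_bijective.injective ?_)
      rw [valuation_map, hxy, ← valuation_map]
    · obtain ⟨y, hy⟩ := hN'.valuation_bijective.surjective (tensorMap R S C r.i.hom ∘ₗ φ)
      refine ⟨r.r y, ?_⟩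
      rw [valuation_map, hy]
      exact LinearMap.ext fun c => LinearMap.congr_fun
        (congrArg ModuleCat.Hom.hom (r.map (tensorFunctor R S C)).retract) (φ c)

theorem auslanderClass.directSum (hC : HasDegreewiseFiniteResolution (ModuleCat.of R C))
    {J : Type u} (N : J → ModuleCat.{u} S) (hN : ∀ j, auslanderClass R S C (N j)) :
    auslanderClass R S C (ModuleCat.of S (⨁ j, N j)) where
  tor_eq_zero i hi := by
    classical
    obtain ⟨k, rfl⟩ := Nat.exists_eq_add_of_le' hi
    rw [isZero_bimoduleTor_iff R C _ hi]
    exact subsingleton_ext_succ_coproduct (ModuleCat.coproductCoconeIsColimit N) _ k fun j =>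
      (isZero_bimoduleTor_iff R C (N j) hi).1 ((hN j).tor_eq_zero _ hi)
  ext_eq_zero i hi := by
    classical
    obtain ⟨k, rfl⟩ := Nat.exists_eq_add_of_le' hi
    exact subsingleton_ext_right_of_retract
      (Retract.ofIso (tensorDirectSum R S C fun j => N j).toModuleIso)
      (subsingleton_ext_succ_directSum hC
        (fun j => ModuleCat.of R (BalancedTensor R S C (N j))) k
        fun j => (hN j).ext_eq_zero _ hi)
  valuation_bijective := by
    classical
    have : Module.Finite R C := hC.finite
    exact valuation_directSum_bijective fun j => (hN j).valuation_bijective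

theorem IsLeftSemidualizing.auslanderClass_self (hC : IsLeftSemidualizing R S C) :
    auslanderClass R S C (ModuleCat.of S S) where
  tor_eq_zero i hi := by
    obtain ⟨k, rfl⟩ := Nat.exists_eq_add_of_le' hi
    exact (isZero_bimoduleTor_iff R C _ hi).2 (Ext.subsingleton_of_projective _ _ k)
  ext_eq_zero i hi := subsingleton_ext_right_of_retract
    (Retract.ofIso (tensorRid R S C).toModuleIso) (hC.ext_left i hi)
  valuation_bijective :=
    (Function.Bijective.of_comp_iff' ((LinearEquiv.refl R C).arrowCongrAddEquiv
      (tensorRid R S C)).bijective _).1 hC.homothety_right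

theorem IsLeftSemidualizing.auslanderClass_of_projective (hC : IsLeftSemidualizing R S C)
    (P : ModuleCat.{u} S) [Projective P] : auslanderClass R S C P := by
  classical
  have hP : Module.Projective S P := (IsProjective.iff_projective P).2 inferInstance
  obtain ⟨s, hs⟩ := hP.out
  let e := finsuppLEquivDirectSum S S P
  refine .of_retract ⟨ModuleCat.ofHom (e.toLinearMap ∘ₗ s),
    ModuleCat.ofHom (Finsupp.linearCombination S id ∘ₗ e.symm.toLinearMap), ?_⟩
    (.directSum hC.finite_left (fun _ : P => ModuleCat.of S S) fun _ => hC.auslanderClass_self)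
  ext x
  exact (congrArg _ (e.symm_apply_apply (s x))).trans (hs x)

end Auslander

section TorOneVanishing

variable {R S : Type u} [Ring R] [Ring S] {C : Type u} [AddCommGroup C] [Module R C]
  [Module Sᵐᵒᵖ C] {T : ShortComplex (ModuleCat.{u} S)}

theorem valuation_X₁_injective (hT : T.ShortExact)
    (h₂ : Function.Injective (valuation R S C T.X₂)) :
    Function.Injective (valuation R S C T.X₁) := fun x y hxy =>
  hT.moduleCat_injective_f <| h₂ <| by rw [valuation_map, hxy, ← valuation_map]

variable [SMulCommClass R Sᵐᵒᵖ C]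

theorem valuation_X₁_surjective (hT : T.ShortExact) (hTor : IsZero (bimoduleTor R S C 1 T.X₃))
    (h₂ : Function.Surjective (valuation R S C T.X₂))
    (h₃ : Function.Injective (valuation R S C T.X₃)) :
    Function.Surjective (valuation R S C T.X₁) := by
  intro φ
  have hCT := shortExact_tensorFunctor hT hTor
  obtain ⟨y, hy⟩ := h₂ (tensorMap R S C T.f.hom ∘ₗ φ)
  have hgy : T.g y = 0 := h₃ <| by
    rw [map_zero, valuation_map, hy]
    exact LinearMap.ext fun c => (T.map (tensorFunctor R S C)).moduleCat_zero_apply (φ c)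
  obtain ⟨x, rfl⟩ :=
    ((ShortComplex.ShortExact.moduleCat_exact_iff_function_exact T).1 hT.exact y).1 hgy
  rw [valuation_map] at hy
  exact ⟨x, LinearMap.ext fun c => hCT.moduleCat_injective_f (LinearMap.congr_fun hy c)⟩

theorem subsingleton_ext_one_tensor_X₁ (hT : T.ShortExact)
    (hTor : IsZero (bimoduleTor R S C 1 T.X₃))
    (hext₂ : Subsingleton (Ext (ModuleCat.of R C) ((tensorFunctor R S C).obj T.X₂) 1))
    (h₃ : Function.Surjective (valuation R S C T.X₃)) :
    Subsingleton (Ext (ModuleCat.of R C) ((tensorFunctor R S C).obj T.X₁) 1) := by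
  refine subsingleton_ext_one_of_forall_exists_lift (shortExact_tensorFunctor hT hTor) hext₂
    fun φ => ?_
  obtain ⟨z, hz⟩ := h₃ φ.hom
  obtain ⟨y, rfl⟩ := hT.moduleCat_surjective_g z
  exact ⟨ModuleCat.ofHom (valuation R S C T.X₂ y),
    ModuleCat.hom_ext ((valuation_map T.g.hom y).symm.trans hz)⟩

theorem valuation_X₃_surjective (hT : T.ShortExact) (hTor : IsZero (bimoduleTor R S C 1 T.X₃))
    (hext₁ : Subsingleton (Ext (ModuleCat.of R C) ((tensorFunctor R S C).obj T.X₁) 1))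
    (h₂ : Function.Surjective (valuation R S C T.X₂)) :
    Function.Surjective (valuation R S C T.X₃) := by
  intro φ
  obtain ⟨ψ, hψ⟩ := exists_lift_of_subsingleton_ext_one (shortExact_tensorFunctor hT hTor) hext₁
    (ModuleCat.ofHom φ)
  obtain ⟨y, hy⟩ := h₂ ψ.hom
  exact ⟨T.g y, (valuation_map T.g.hom y).trans <| by
    rw [hy]; exact congrArg ModuleCat.Hom.hom hψ⟩

theorem valuation_X₃_injective (hT : T.ShortExact) (hTor : IsZero (bimoduleTor R S C 1 T.X₃))
    (h₁ : Function.Surjective (valuation R S C T.X₁))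
    (h₂ : Function.Injective (valuation R S C T.X₂)) :
    Function.Injective (valuation R S C T.X₃) := by
  refine (injective_iff_map_eq_zero _).2 fun z hz => ?_
  obtain ⟨y, rfl⟩ := hT.moduleCat_surjective_g z
  have hCT := shortExact_tensorFunctor hT hTor
  have := hCT.mono_f
  have hy : ModuleCat.ofHom (valuation R S C T.X₂ y) ≫ (T.map (tensorFunctor R S C)).g = 0 :=
    ModuleCat.hom_ext ((valuation_map T.g.hom y).symm.trans hz)
  obtain ⟨x, hx⟩ := h₁ (hCT.exact.lift _ hy).hom
  have hfx : T.f x = y := h₂ <| by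
    rw [valuation_map, hx]
    exact congrArg ModuleCat.Hom.hom (hCT.exact.lift_f _ hy)
  rw [← hfx, T.moduleCat_zero_apply]

theorem subsingleton_ext_tensor_succ_iff (hT : T.ShortExact)
    (hTor : IsZero (bimoduleTor R S C 1 T.X₃)) {i : ℕ}
    (h : Subsingleton (Ext (ModuleCat.of R C) ((tensorFunctor R S C).obj T.X₂) i))
    (h' : Subsingleton (Ext (ModuleCat.of R C) ((tensorFunctor R S C).obj T.X₂) (i + 1))) :
    Subsingleton (Ext (ModuleCat.of R C) ((tensorFunctor R S C).obj T.X₁) (i + 1)) ↔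
      Subsingleton (Ext (ModuleCat.of R C) ((tensorFunctor R S C).obj T.X₃) i) :=
  subsingleton_ext_succ_right_iff (shortExact_tensorFunctor hT hTor) _ i h h'

theorem auslanderClass.X₃_of_shortExact (hT : T.ShortExact)
    (hTor : IsZero (bimoduleTor R S C 1 T.X₃)) (h₁ : auslanderClass R S C T.X₁)
    (h₂ : auslanderClass R S C T.X₂) : auslanderClass R S C T.X₃ where
  tor_eq_zero i hi := by
    obtain rfl | ⟨i, rfl⟩ : i = 1 ∨ ∃ k, i = k + 1 + 1 := by
      obtain ⟨k, rfl⟩ := Nat.exists_eq_add_of_le' hi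
      cases k <;> simp
    · exact hTor
    · have h₁ := (isZero_bimoduleTor_iff R C _ (by lia)).1 (h₁.tor_eq_zero (i + 1) (by lia))
      have h₂ (j : ℕ) (hj) := (isZero_bimoduleTor_iff R C _ hj).1 (h₂.tor_eq_zero j hj)
      exact (isZero_bimoduleTor_iff R C _ hi).2 <|
        (subsingleton_ext_succ_left_iff hT _ _ (h₂ _ (by lia)) (h₂ _ (by lia))).2 h₁
  ext_eq_zero i hi :=
    (subsingleton_ext_tensor_succ_iff hT hTor (h₂.ext_eq_zero i hi)
      (h₂.ext_eq_zero (i + 1) (by lia))).1 (h₁.ext_eq_zero (i + 1) (by lia))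
  valuation_bijective :=
    ⟨valuation_X₃_injective hT hTor h₁.valuation_bijective.surjective
      h₂.valuation_bijective.injective,
    valuation_X₃_surjective hT hTor (h₁.ext_eq_zero 1 le_rfl) h₂.valuation_bijective.surjective⟩

end TorOneVanishing

section UltimatelyClosed

variable {R S : Type u} [Ring R] [Ring S] {C : Type u} [AddCommGroup C] [Module R C]
  [Module Sᵐᵒᵖ C] [SMulCommClass R Sᵐᵒᵖ C] {N : ModuleCat.{u} S} (Q : ProjectiveResolution N)

theorem isZero_bimoduleTor_resolutionImage_iff (k : ℕ) {i : ℕ} (hi : 1 ≤ i) :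
    IsZero (bimoduleTor R S C i (resolutionImage Q k)) ↔ IsZero (bimoduleTor R S C (k + i) N) := by
  rw [isZero_bimoduleTor_iff R C _ hi, isZero_bimoduleTor_iff R C _ (by lia),
    resolutionImage.subsingleton_ext_add_iff Q _ k hi]

variable {Q}

theorem IsLeftSemidualizing.valuation_resolutionImage_bijective (hC : IsLeftSemidualizing R S C)
    (hN : ∀ i, 1 ≤ i → IsZero (bimoduleTor R S C i N)) (k : ℕ) :
    Function.Bijective (valuation R S C (resolutionImage Q (k + 2))) := by
  have hinj (j : ℕ) : Function.Injective (valuation R S C (resolutionImage Q (j + 1))) :=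
    valuation_X₁_injective (resolutionImage.shortExact Q j)
      (hC.auslanderClass_of_projective (Q.complex.X j)).valuation_bijective.injective
  refine ⟨hinj (k + 1), ?_⟩
  exact valuation_X₁_surjective (resolutionImage.shortExact Q (k + 1))
    ((isZero_bimoduleTor_resolutionImage_iff Q (k + 1) le_rfl).2 (hN _ (by lia)))
      (hC.auslanderClass_of_projective (Q.complex.X (k + 1))).valuation_bijective.surjective
    (hinj k)

/- Every syzygy of `N` gains one degree: surjectivity of `μ` at a syzygy kills `Ext^1` at the next
one, and tensoring with `C` keeps the dimension shifting exact because `Tor_1^S(C, -)` vanishes. -/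
theorem IsLeftSemidualizing.subsingleton_ext_tensor_resolutionImage
    (hC : IsLeftSemidualizing R S C) (hN : ∀ i, 1 ≤ i → IsZero (bimoduleTor R S C i N))
    (k i : ℕ) : Subsingleton (Ext (ModuleCat.of R C)
      ((tensorFunctor R S C).obj (resolutionImage Q (i + 3 + k))) (i + 1)) := by
  have hP (j i : ℕ) (hi : 1 ≤ i) : Subsingleton (Ext (ModuleCat.of R C)
      ((tensorFunctor R S C).obj (Q.complex.X j)) i) :=
    (hC.auslanderClass_of_projective (Q.complex.X j)).ext_eq_zero i hi
  have hTor (j : ℕ) : IsZero (bimoduleTor R S C 1 (resolutionImage Q j)) :=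
    (isZero_bimoduleTor_resolutionImage_iff Q j le_rfl).2 (hN _ (by lia))
  induction i with
  | zero =>
    rw [show 0 + 3 + k = k + 2 + 1 by lia, zero_add]
    exact subsingleton_ext_one_tensor_X₁ (T := resolutionImage.shortComplex Q (k + 2))
      (resolutionImage.shortExact Q (k + 2)) (hTor (k + 2)) (hP (k + 2) 1 le_rfl)
      (hC.valuation_resolutionImage_bijective (Q := Q) hN k).surjective
  | succ i ih =>
    rw [show i + 1 + 3 + k = i + 3 + k + 1 by lia]
    generalize i + 3 + k = j at ih ⊢
    exact (subsingleton_ext_tensor_succ_iff (resolutionImage.shortExact Q j) (hTor j)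
      (hP j (i + 1) (by lia)) (hP j (i + 2) (by lia))).2 ih

theorem IsLeftSemidualizing.auslanderClass_resolutionImage (hC : IsLeftSemidualizing R S C)
    {P : ProjectiveResolution (ModuleCat.of R C)} {m : ℕ} (hP : IsUltimatelyClosedAt P m)
    (hN : ∀ i, 1 ≤ i → IsZero (bimoduleTor R S C i N)) :
    auslanderClass R S C (resolutionImage Q (m + 2)) where
  tor_eq_zero i hi := (isZero_bimoduleTor_resolutionImage_iff Q (m + 2) hi).2 (hN _ (by lia))
  ext_eq_zero := hP.subsingleton_ext fun i hi him => by
    obtain ⟨i, rfl⟩ := Nat.exists_eq_add_of_le' hi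
    obtain ⟨k, rfl⟩ := Nat.exists_eq_add_of_le him
    rw [show i + 1 + k + 2 = i + 3 + k by lia]
    exact hC.subsingleton_ext_tensor_resolutionImage hN k i
  valuation_bijective := hC.valuation_resolutionImage_bijective hN m

theorem IsLeftSemidualizing.auslanderClass_of_isZero_bimoduleTor (hC : IsLeftSemidualizing R S C)
    (hclosed : HasUltimatelyClosedResolution (ModuleCat.of R C))
    (hN : ∀ i, 1 ≤ i → IsZero (bimoduleTor R S C i N)) : auslanderClass R S C N := by
  obtain ⟨m, -, P, hP⟩ := hclosed
  have Q := projectiveResolution N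
  exact Nat.decreasingInduction (motive := fun k _ => auslanderClass R S C (resolutionImage Q k))
    (fun k _ hk => .X₃_of_shortExact (resolutionImage.shortExact Q k)
      ((isZero_bimoduleTor_resolutionImage_iff Q k le_rfl).2 (hN _ (by lia))) hk
      (hC.auslanderClass_of_projective (Q.complex.X k)))
    (hC.auslanderClass_resolutionImage hP hN) (Nat.zero_le (m + 2))

end UltimatelyClosed

section RelativeDimension

variable {A : Type u} [Ring A] {𝒳 : ModuleCat.{u} A → Prop} {N : ModuleCat.{u} A} {n : ℕ}

theorem hasResolutionOfLength_zero (hN : 𝒳 N) : HasResolutionOfLength 𝒳 N 0 := by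
  refine ⟨fun i => Nat.casesOn i N fun _ => ModuleCat.of A PUnit, fun _ => 0, LinearMap.id,
    fun i hi => ?_, fun i hi => ?_, Function.surjective_id, fun x => ?_, fun i x => ?_⟩
  · obtain rfl : i = 0 := by lia
    exact hN
  · obtain ⟨i, rfl⟩ := Nat.exists_eq_add_of_le' hi
    exact inferInstanceAs (Subsingleton PUnit)
  · exact ⟨fun hx => ⟨0, hx.symm⟩, fun ⟨_, hx⟩ => hx.symm⟩
  · exact ⟨fun _ => ⟨0, Subsingleton.elim (α := PUnit) _ _⟩, fun _ => rfl⟩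

theorem HasResolutionOfLength.succ {T : ShortComplex (ModuleCat.{u} A)} (hT : T.ShortExact)
    (h₂ : 𝒳 T.X₂) (h₁ : HasResolutionOfLength 𝒳 T.X₁ n) :
    HasResolutionOfLength 𝒳 T.X₃ (n + 1) := by
  obtain ⟨X, d, ε, hX, h0, hε, hdε, hd⟩ := h₁
  refine ⟨fun i => Nat.casesOn i T.X₂ X, fun i => match i with
    | 0 => T.f.hom ∘ₗ ε
    | i + 1 => d i, T.g.hom, ?_, ?_, hT.moduleCat_surjective_g, fun x => ?_, ?_⟩
  · rintro (_ | i) hi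
    exacts [h₂, hX i (by lia)]
  · rintro (_ | i) hi
    exacts [absurd hi (by lia), h0 i (by lia)]
  · refine ((ShortComplex.ShortExact.moduleCat_exact_iff_function_exact T).1 hT.exact x).trans ?_
    exact hε.exists.trans Iff.rfl
  · rintro (_ | i)
    exacts [fun x => (map_eq_zero_iff T.f.hom hT.moduleCat_injective_f).trans (hdε x), hd i]

theorem HasResolutionOfLength.exists_of_zero (h : HasResolutionOfLength 𝒳 N 0) :
    ∃ X : ModuleCat.{u} A, 𝒳 X ∧ Nonempty (X ≃ₗ[A] N) := by
  obtain ⟨X, d, ε, hX, h0, hε, hdε, -⟩ := h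
  have := h0 1 zero_lt_one
  refine ⟨X 0, hX 0 le_rfl, ⟨.ofBijective ε ⟨(injective_iff_map_eq_zero _).2 fun x hx => ?_, hε⟩⟩⟩
  obtain ⟨y, rfl⟩ := (hdε x).1 hx
  rw [Subsingleton.elim y 0, map_zero]

theorem HasResolutionOfLength.exists_of_succ (h : HasResolutionOfLength 𝒳 N (n + 1)) :
    ∃ (X : ModuleCat.{u} A) (ε : X →ₗ[A] N), Function.Surjective ε ∧ 𝒳 X ∧
      HasResolutionOfLength 𝒳 (ModuleCat.of A (LinearMap.ker ε)) n := by
  obtain ⟨X, d, ε, hX, h0, hε, hdε, hd⟩ := h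
  refine ⟨X 0, ε, hε, hX 0 (by lia), fun i => X (i + 1), fun i => d (i + 1),
    (d 0).codRestrict (LinearMap.ker ε) hdε.apply_apply_eq_zero,
    fun i hi => hX _ (by lia), fun i hi => h0 _ (by lia), ?_, ?_, fun i => hd (i + 1)⟩
  · rintro ⟨x, hx⟩
    obtain ⟨y, rfl⟩ := (hdε x).1 hx
    exact ⟨y, rfl⟩
  · exact fun x => Subtype.ext_iff.trans (hd 0 x)

theorem relativeProjectiveDimension_le_iff :
    relativeProjectiveDimension 𝒳 N ≤ (n : ℕ∞) ↔ ∃ m ≤ n, HasResolutionOfLength 𝒳 N m := by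
  constructor
  · intro h
    obtain ⟨_, ⟨m, rfl, hm⟩, hmn⟩ := sInf_lt_iff.1 <|
      h.trans_lt (b := (n : ℕ∞)) (c := ((n + 1 : ℕ) : ℕ∞)) (by exact_mod_cast n.lt_succ_self)
    exact ⟨m, Nat.lt_succ_iff.1 (by exact_mod_cast hmn), hm⟩
  · rintro ⟨m, hmn, hm⟩
    have hmem : (m : ℕ∞) ∈ {k : ℕ∞ | ∃ n : ℕ, k = n ∧ HasResolutionOfLength 𝒳 N n} := ⟨m, rfl, hm⟩
    exact (sInf_le hmem).trans (Nat.cast_le.2 hmn)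

theorem HasResolutionOfLength.subsingleton_ext {D : ModuleCat.{u} A}
    (h𝒳 : ∀ X, 𝒳 X → ∀ i, 1 ≤ i → Subsingleton (Ext X D i)) (h : HasResolutionOfLength 𝒳 N n)
    {i : ℕ} (hi : n < i) : Subsingleton (Ext N D i) := by
  induction n generalizing N i with
  | zero =>
    obtain ⟨X, hX, ⟨e⟩⟩ := h.exists_of_zero
    exact subsingleton_ext_left_of_retract (.ofIso e.toModuleIso.symm) (h𝒳 X hX i hi)
  | succ n ih =>
    obtain ⟨X, ε, hε, hX, hK⟩ := h.exists_of_succ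
    obtain ⟨i, rfl⟩ := Nat.exists_eq_add_of_le' (show 1 ≤ i by lia)
    exact (subsingleton_ext_succ_left_iff (LinearMap.shortExact_shortComplexKer hε) D i
      (h𝒳 X hX i (by lia)) (h𝒳 X hX (i + 1) (by lia))).2 (ih hK (by lia))

end RelativeDimension

section AuslanderDimension

variable {R S : Type u} [Ring R] [Ring S] {C : Type u} [AddCommGroup C] [Module R C]
  [Module Sᵐᵒᵖ C] [SMulCommClass R Sᵐᵒᵖ C] {N : ModuleCat.{u} S} {n : ℕ}

theorem isZero_bimoduleTor_of_auslanderProjectiveDimension_le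
    (hN : auslanderProjectiveDimension R S C N ≤ (n : ℕ∞)) {i : ℕ} (hi : n < i) :
    IsZero (bimoduleTor R S C i N) := by
  obtain ⟨m, hmn, hm⟩ := relativeProjectiveDimension_le_iff.1 hN
  exact (isZero_bimoduleTor_iff R C N (by lia)).2 <| hm.subsingleton_ext
    (fun X hX j hj => (isZero_bimoduleTor_iff R C X hj).1 (hX.tor_eq_zero j hj)) (by lia)

theorem IsLeftSemidualizing.hasResolutionOfLength_auslanderClass (hC : IsLeftSemidualizing R S C)
    (hclosed : HasUltimatelyClosedResolution (ModuleCat.of R C))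
    (hN : ∀ i, n < i → IsZero (bimoduleTor R S C i N)) :
    HasResolutionOfLength (auslanderClass R S C) N n := by
  induction n generalizing N with
  | zero => exact hasResolutionOfLength_zero (hC.auslanderClass_of_isZero_bimoduleTor hclosed hN)
  | succ n ih =>
    let P := projectiveResolution N
    refine .succ (resolutionImage.shortExact P 0)
      (hC.auslanderClass_of_projective (P.complex.X 0)) (ih fun i hi => ?_)
    exact (isZero_bimoduleTor_resolutionImage_iff P 1 (by lia)).2 (hN _ (by lia))

theorem IsLeftSemidualizing.auslanderProjectiveDimension_le_iff (hC : IsLeftSemidualizing R S C)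
    (hclosed : HasUltimatelyClosedResolution (ModuleCat.of R C)) :
    auslanderProjectiveDimension R S C N ≤ (n : ℕ∞) ↔
      ∀ i, n < i → IsZero (bimoduleTor R S C i N) :=
  ⟨fun hN _ => isZero_bimoduleTor_of_auslanderProjectiveDimension_le hN, fun hN =>
    relativeProjectiveDimension_le_iff.2
      ⟨n, le_rfl, hC.hasResolutionOfLength_auslanderClass hclosed hN⟩⟩

end AuslanderDimension

end

end SemidualizingBimodule

open SemidualizingBimodule in
theorem corollary4p11_general {R S : Type u} [Ring R] [Ring S] {C : Type u} [AddCommGroup C]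
    [Module R C] [Module Sᵐᵒᵖ C] [SMulCommClass R Sᵐᵒᵖ C] (hC : IsLeftSemidualizing R S C)
    (hfinite : HasDegreewiseFiniteResolution (ModuleCat.of Sᵐᵒᵖ C))
    (hclosed : HasUltimatelyClosedResolution (ModuleCat.of R C)) (n : ℕ) :
    projectiveDimension (ModuleCat.of Sᵐᵒᵖ C) ≤ (n : WithBot ℕ∞) ↔
      ∀ N : ModuleCat.{u} S, auslanderProjectiveDimension R S C N ≤ (n : ℕ∞) := by
  simp only [hC.auslanderProjectiveDimension_le_iff hclosed]
  rw [← forall_isZero_bimoduleTor_succ_iff (R := R) hfinite n]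
  refine ⟨fun hTor N i hi => ?_, fun hTor N => hTor N (n + 1) n.lt_succ_self⟩
  have hpd := (forall_isZero_bimoduleTor_succ_iff hfinite n).1 hTor
  obtain ⟨k, rfl⟩ := Nat.exists_eq_add_of_le' (show 1 ≤ i by lia)
  exact (forall_isZero_bimoduleTor_succ_iff hfinite k).2
    (hpd.trans (by exact_mod_cast Nat.lt_succ_iff.1 hi)) N

theorem corollary4p11 (R S : Type u) [Ring R] [Ring S] (C : Type u) [AddCommGroup C]
    [Module R C] [Module Sᵐᵒᵖ C] [SMulCommClass R Sᵐᵒᵖ C]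
    (hC : SemidualizingBimodule.IsSemidualizing R S C)
    (hclosed : SemidualizingBimodule.HasUltimatelyClosedResolution (ModuleCat.of R C)) (n : ℕ) :
    projectiveDimension (ModuleCat.of Sᵐᵒᵖ C) ≤ (n : WithBot ℕ∞) ↔
      ∀ N : ModuleCat.{u} S,
        SemidualizingBimodule.auslanderProjectiveDimension R S C N ≤ (n : ℕ∞) :=
  corollary4p11_general hC.isLeftSemidualizing hC.finite_right hclosed n
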